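/- Let $n\ge 2$. For a closed set $\Sigma\subset\mathbb R^n$, $x\in\Sigma$ and $r>0$, let $$\theta_\Sigma(x,r)=\frac1r\min_{L}\operatorname{HD}\bigl[\Sigma\cap B(x,r),\,(x+L)\cap B(x,r)\bigr],$$ where $L$ ranges over all $(n-1)$-dimensional linear subspaces of $\mathbb R^n$, $B(x,r)$ is the closed Euclidean ball with centre $x$ and radius $r$, and $\operatorname{HD}[A,B]=\max\{\sup_{a\in A}\operatorname{dist}(a,B),\sup_{b\in B}\operatorname{dist}(b,A)\}$ is the Hausdorff distance. A point $x\in\Sigma$ is called a flat point of $\Sigma$ if $\lim_{r\downarrow0}\theta_\Sigma(x,r)=0$. Let $h:\mathbb R^n\to\mathbb R$ be a nonconstant harmonic polynomial, and let $\Sigma_h=\{x\in\mathbb R^n:h(x)=0\}$. Then $$\{x\in\Sigma_h: x\text{ is a flat point of }\Sigma_h\}=\{x\in\Sigma_h: Dh(x)\neq 0\},$$ where $Dh(x)$ denotes the total derivative of $h$ at $x$. -/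

import Mathlib

/-- The zero set `{x ∈ ℝⁿ : f x = 0}` of a function `f : ℝⁿ → ℝ`. -/
def zeroSet {n : ℕ} (f : EuclideanSpace ℝ (Fin n) → ℝ) : Set (EuclideanSpace ℝ (Fin n)) :=
  {x | f x = 0}

/-- `f : ℝⁿ → ℝ` is a polynomial function in the coordinates of `ℝⁿ`. -/
def IsPolynomialFunction {n : ℕ} (f : EuclideanSpace ℝ (Fin n) → ℝ) : Prop :=
  ∃ p : MvPolynomial (Fin n) ℝ, ∀ x, f x = MvPolynomial.eval (fun i => x i) p

/-- `f : ℝⁿ → ℝ` is a harmonic polynomial: a polynomial function whose Laplacian vanishes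
everywhere (`HarmonicOnNhd` is Mathlib's harmonicity: twice continuously differentiable with
vanishing Laplacian). -/
def IsHarmonicPolynomial {n : ℕ} (f : EuclideanSpace ℝ (Fin n) → ℝ) : Prop :=
  IsPolynomialFunction f ∧ InnerProductSpace.HarmonicOnNhd f Set.univ

/-- The Grassmannian `G(n, n - 1)` of hyperplanes of `ℝⁿ` through the origin. -/
def LinearHyperplane (n : ℕ) : Type :=
  {L : Submodule ℝ (EuclideanSpace ℝ (Fin n)) // Module.finrank ℝ L + 1 = n}

/-- The local flatness `θ_Σ(x, r)` of a closed set `Σ ⊆ ℝⁿ` (here `A`) near `x ∈ Σ` at scale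
`r > 0`: `1 / r` times the minimum, over all linear hyperplanes `L`, of the Hausdorff distance
between `Σ ∩ B(x, r)` and `(x + L) ∩ B(x, r)`, with `B(x, r)` the closed ball.
For `n ≥ 1` and `x ∈ Σ` both sets are bounded and contain `x`, so the Hausdorff distances are
genuine finite ones, and the infimum is over a nonempty family bounded below by `0`. -/
noncomputable def localFlatness {n : ℕ} (A : Set (EuclideanSpace ℝ (Fin n)))
    (x : EuclideanSpace ℝ (Fin n)) (r : ℝ) : ℝ :=
  (1 / r) * ⨅ L : LinearHyperplane n,
    Metric.hausdorffDist (A ∩ Metric.closedBall x r)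
      (((fun y => x + y) '' (L.1 : Set (EuclideanSpace ℝ (Fin n)))) ∩ Metric.closedBall x r)

/-- `x` is a flat point of `A`: `x ∈ A` and `θ_A(x, r) → 0` as `r ↓ 0`. -/
def IsFlatPoint {n : ℕ} (A : Set (EuclideanSpace ℝ (Fin n)))
    (x : EuclideanSpace ℝ (Fin n)) : Prop :=
  x ∈ A ∧ Filter.Tendsto (fun r : ℝ => localFlatness A x r)
    (nhdsWithin 0 (Set.Ioi 0)) (nhds 0)

/-! Where the derivative is nonzero, the first-order expansion traps the zeros near the tangent
hyperplane, and the intermediate value theorem puts zeros near each of its points.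

For the converse, move the flat point to the origin and let `q`, of degree `m`, be the lowest
nonzero homogeneous component of the translated polynomial `p`. It is the limit of `p (r • a) / r ^
m`. Flatness and compactness of the sphere give one normal `e` such that, at arbitrarily small
scales, the zeros lie near the hyperplane orthogonal to `e`. By the intermediate value theorem `q`
then keeps one sign on `0 < ⟪e, y⟫` (`mul_nonneg_of_zeros_near_hyperplane`).

If the derivative vanished, then `2 ≤ m` and `q` would be harmonic. By parity, either `q` (`m` even)
or `⟪e, y⟫ * q` (`m` odd) has one sign on the whole space. But `q` is orthogonal, for a radial
weight, to harmonic homogeneous polynomials of other degrees, in particular to `1` and `⟪e, y⟫`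
(`integral_radialWeight_mul_eq_zero`). So `q = 0`, a contradiction. -/

open MeasureTheory Filter Topology

/-- The polynomial function on `ℝⁿ` defined by a multivariate polynomial. -/
noncomputable def polyEval {n : ℕ} (p : MvPolynomial (Fin n) ℝ)
    (y : EuclideanSpace ℝ (Fin n)) : ℝ :=
  MvPolynomial.eval (fun i => y i) p

/-! ### Calculus of polynomial functions and their homogeneous components -/

section Polynomial

variable {n : ℕ}

theorem polyEval_add (p q : MvPolynomial (Fin n) ℝ) (y : EuclideanSpace ℝ (Fin n)) :
    polyEval (p + q) y = polyEval p y + polyEval q y := by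
  simp [polyEval]

theorem polyEval_mul (p q : MvPolynomial (Fin n) ℝ) (y : EuclideanSpace ℝ (Fin n)) :
    polyEval (p * q) y = polyEval p y * polyEval q y := by
  simp [polyEval]

theorem polyEval_sum {ι : Type*} (s : Finset ι) (p : ι → MvPolynomial (Fin n) ℝ)
    (y : EuclideanSpace ℝ (Fin n)) :
    polyEval (∑ i ∈ s, p i) y = ∑ i ∈ s, polyEval (p i) y := by
  simp [polyEval]

theorem polyEval_X (i : Fin n) (y : EuclideanSpace ℝ (Fin n)) :
    polyEval (MvPolynomial.X i) y = y i := by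
  simp [polyEval]

theorem continuous_polyEval (p : MvPolynomial (Fin n) ℝ) : Continuous (polyEval p) :=
  (MvPolynomial.continuous_eval p).comp (by fun_prop)

theorem eq_zero_of_polyEval_eq_zero {p : MvPolynomial (Fin n) ℝ} (h : ∀ y, polyEval p y = 0) :
    p = 0 := by
  refine MvPolynomial.funext fun z => ?_
  simpa [polyEval] using h (WithLp.toLp 2 z)

theorem MvPolynomial.IsHomogeneous.polyEval_smul {p : MvPolynomial (Fin n) ℝ} {m : ℕ}
    (hp : p.IsHomogeneous m) (r : ℝ) (y : EuclideanSpace ℝ (Fin n)) :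
    polyEval p (r • y) = r ^ m * polyEval p y := by
  unfold polyEval
  rw [MvPolynomial.eval_eq, MvPolynomial.eval_eq, Finset.mul_sum]
  refine Finset.sum_congr rfl fun d hd => ?_
  have hdeg : ∑ i ∈ d.support, d i = m := by
    have := hp (MvPolynomial.mem_support_iff.1 hd)
    rwa [Finsupp.weight_apply, Finsupp.sum, Finset.sum_congr rfl
      (fun i _ => by simp : ∀ i ∈ d.support, d i • (1 : Fin n → ℕ) i = d i)] at this
  simp only [PiLp.smul_apply, smul_eq_mul, mul_pow, Finset.prod_mul_distrib,
    Finset.prod_pow_eq_pow_sum, hdeg]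
  ring

theorem hasFDerivAt_polyEval (p : MvPolynomial (Fin n) ℝ) (y : EuclideanSpace ℝ (Fin n)) :
    HasFDerivAt (polyEval p)
      (∑ i, polyEval (MvPolynomial.pderiv i p) y • EuclideanSpace.proj (𝕜 := ℝ) i) y := by
  induction p using MvPolynomial.induction_on with
  | C a =>
    have : (polyEval (MvPolynomial.C a) : EuclideanSpace ℝ (Fin n) → ℝ) = fun _ => a := by
      ext; simp [polyEval]
    rw [this]
    convert hasFDerivAt_const a y
    simp [polyEval]
  | add p q hp hq =>
    have : (polyEval (p + q) : EuclideanSpace ℝ (Fin n) → ℝ) = polyEval p + polyEval q := by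
      ext; simp [polyEval]
    rw [this]
    refine (hp.add hq).congr_fderiv ?_
    rw [← Finset.sum_add_distrib]
    refine Finset.sum_congr rfl fun i _ => ?_
    rw [map_add, polyEval_add, add_smul]
  | mul_X p j hp =>
    have : (polyEval (p * MvPolynomial.X j) : EuclideanSpace ℝ (Fin n) → ℝ) =
        fun y => polyEval p y * y j := by
      ext; simp [polyEval]
    rw [this]
    have hj : HasFDerivAt (fun y : EuclideanSpace ℝ (Fin n) => y j)
        (EuclideanSpace.proj (𝕜 := ℝ) j) y :=
      (EuclideanSpace.proj (𝕜 := ℝ) j).hasFDerivAt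
    refine (hp.mul hj).congr_fderiv ?_
    ext v
    simp only [Derivation.leibniz, MvPolynomial.pderiv_X, smul_eq_mul, polyEval_add,
      polyEval_mul, sum_apply, add_apply, smul_apply, add_mul, Finset.sum_add_distrib, polyEval_X,
      Finset.mul_sum, mul_assoc]
    congr 1
    rw [Finset.sum_eq_single j]
    · simp [polyEval]
    · intro i _ hij
      simp [hij.symm, polyEval]
    · simp

theorem fderiv_polyEval_single (p : MvPolynomial (Fin n) ℝ) (y : EuclideanSpace ℝ (Fin n))
    (i : Fin n) :
    fderiv ℝ (polyEval p) y (EuclideanSpace.single i 1) =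
      polyEval (MvPolynomial.pderiv i p) y := by
  rw [(hasFDerivAt_polyEval p y).fderiv]
  simp

theorem contDiff_polyEval (p : MvPolynomial (Fin n) ℝ) {k : WithTop ℕ∞} :
    ContDiff ℝ k (polyEval p) := by
  have h : AnalyticOnNhd ℝ (fun x : EuclideanSpace ℝ (Fin n) =>
      MvPolynomial.eval (EuclideanSpace.equiv (Fin n) ℝ x) p) Set.univ :=
    AnalyticOnNhd.eval_continuousLinearMap
      (EuclideanSpace.equiv (Fin n) ℝ : EuclideanSpace ℝ (Fin n) →L[ℝ] (Fin n → ℝ)) p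
  exact h.contDiff

/-- The Laplacian of a multivariate polynomial. -/
noncomputable def polyLaplacian (p : MvPolynomial (Fin n) ℝ) : MvPolynomial (Fin n) ℝ :=
  ∑ i, MvPolynomial.pderiv i (MvPolynomial.pderiv i p)

theorem laplacian_polyEval (p : MvPolynomial (Fin n) ℝ) (y : EuclideanSpace ℝ (Fin n)) :
    Laplacian.laplacian (polyEval p) y = polyEval (polyLaplacian p) y := by
  rw [InnerProductSpace.laplacian_eq_iteratedFDeriv_orthonormalBasis (polyEval p)
    (EuclideanSpace.basisFun (Fin n) ℝ), polyLaplacian, polyEval_sum]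
  refine Finset.sum_congr rfl fun i _ => ?_
  have hd : DifferentiableAt ℝ (fderiv ℝ (polyEval p)) y :=
    ((contDiff_polyEval p (k := 2)).fderiv_right (m := 1) (by norm_num)).differentiable
      (by norm_num) y
  have he : (fun z => fderiv ℝ (polyEval p) z (EuclideanSpace.single i 1)) =
      polyEval (MvPolynomial.pderiv i p) := by
    ext z
    exact fderiv_polyEval_single p z i
  have := fderiv_clm_apply hd (differentiableAt_const (EuclideanSpace.single i (1 : ℝ)))
  rw [he] at this
  rw [iteratedFDeriv_two_apply, ← fderiv_polyEval_single, this]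
  simp

theorem homogeneousComponent_pderiv (p : MvPolynomial (Fin n) ℝ) (k : ℕ) (i : Fin n) :
    MvPolynomial.homogeneousComponent k (MvPolynomial.pderiv i p) =
      MvPolynomial.pderiv i (MvPolynomial.homogeneousComponent (k + 1) p) := by
  induction p using MvPolynomial.induction_on' with
  | add p q hp hq => simp only [map_add, hp, hq]
  | monomial s a =>
    have h1 : (MvPolynomial.monomial s a).IsHomogeneous s.degree :=
      MvPolynomial.isHomogeneous_monomial a rfl
    rw [MvPolynomial.homogeneousComponent_of_mem h1]
    -- `h1.pderiv` has degree `s.degree - 1`, truncated at `0`, so constants are treated apart.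
    rcases Nat.eq_zero_or_pos s.degree with h0 | h0
    · have : s = 0 := (Finsupp.degree_eq_zero_iff s).1 h0
      subst this
      simp
    · rw [MvPolynomial.homogeneousComponent_of_mem h1.pderiv]
      split_ifs <;> first | rfl | omega

/-- The Laplacian lowers degree by exactly two, so no cancellation occurs between components. -/
theorem polyLaplacian_homogeneousComponent {p : MvPolynomial (Fin n) ℝ}
    (hp : polyLaplacian p = 0) (k : ℕ) :
    polyLaplacian (MvPolynomial.homogeneousComponent (k + 2) p) = 0 := by
  have := congrArg (MvPolynomial.homogeneousComponent k) hp
  rw [polyLaplacian, map_sum, map_zero] at this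
  simpa only [homogeneousComponent_pderiv, polyLaplacian, add_assoc, one_add_one_eq_two] using this

end Polynomial

/-! ### Orthogonality of harmonic homogeneous polynomials -/

section Weight

variable {n : ℕ}

/-- Squaring removes the corner of the positive part, so the squared weight can be integrated by
parts. -/
theorem hasDerivAt_posPart_sq (u : ℝ) :
    HasDerivAt (fun u : ℝ => (max 0 u) ^ 2) (2 * max 0 u) u := by
  rcases lt_trichotomy u 0 with h | rfl | h
  · rw [max_eq_left h.le, mul_zero]
    refine (hasDerivAt_const u (0 : ℝ)).congr_of_eventuallyEq ?_
    filter_upwards [gt_mem_nhds h] with v hv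
    rw [max_eq_left hv.le]; simp
  · rw [max_self, mul_zero, hasDerivAt_iff_isLittleO]
    refine Asymptotics.IsBigO.trans_isLittleO (g := fun v : ℝ => v ^ 2) ?_ ?_
    · refine Asymptotics.isBigO_of_le _ fun v => ?_
      simp only [max_self, sub_zero, smul_zero, ne_eq, OfNat.ofNat_ne_zero, not_false_eq_true,
        zero_pow, norm_pow, Real.norm_eq_abs]
      refine pow_le_pow_left₀ (abs_nonneg _) ?_ 2
      rw [abs_of_nonneg (le_max_left 0 v)]
      exact max_le (abs_nonneg v) (le_abs_self v)
    · simpa using Asymptotics.isLittleO_pow_id (𝕜 := ℝ) (n := 2) (by norm_num)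
  · rw [max_eq_right h.le]
    have := (hasDerivAt_pow 2 u)
    refine HasDerivAt.congr_of_eventuallyEq (f := fun v : ℝ => v ^ 2) (by simpa using this) ?_
    filter_upwards [lt_mem_nhds h] with v hv
    rw [max_eq_right hv.le]

/-- A radial weight supported in the closed unit ball and positive on the open unit ball. -/
noncomputable def radialWeight (y : EuclideanSpace ℝ (Fin n)) : ℝ := max 0 (1 - ‖y‖ ^ 2)

theorem continuous_radialWeight : Continuous (radialWeight (n := n)) := by
  unfold radialWeight
  fun_prop

theorem hasCompactSupport_radialWeight : HasCompactSupport (radialWeight (n := n)) := by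
  refine HasCompactSupport.intro (isCompact_closedBall 0 1) fun y hy => ?_
  have : 1 < ‖y‖ := by simpa using hy
  exact max_eq_left (by nlinarith)

theorem radialWeight_pos {y : EuclideanSpace ℝ (Fin n)} (hy : ‖y‖ < 1) : 0 < radialWeight y :=
  lt_max_of_lt_right (by nlinarith [norm_nonneg y])

theorem hasFDerivAt_radialWeight_sq (y : EuclideanSpace ℝ (Fin n)) :
    HasFDerivAt (fun y : EuclideanSpace ℝ (Fin n) => radialWeight y ^ 2)
      ((-4 * radialWeight y) • innerSL ℝ y) y := by
  have h1 : HasFDerivAt (fun y : EuclideanSpace ℝ (Fin n) => 1 - ‖y‖ ^ 2)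
      (-(2 • innerSL ℝ y)) y :=
    (hasStrictFDerivAt_norm_sq y).hasFDerivAt.const_sub 1
  refine ((hasDerivAt_posPart_sq (1 - ‖y‖ ^ 2)).comp_hasFDerivAt y h1).congr_fderiv ?_
  ext v
  simp [radialWeight]
  ring

/-- Integrate `w ^ 2 * div G` by parts, with `w` the radial weight: the gradient of `w ^ 2` is `-4 *
w * y`, and compact support leaves no boundary term. This replaces Green's formula on the sphere. -/
theorem integral_radialWeight_mul_euler (G : Fin n → MvPolynomial (Fin n) ℝ)
    (hG : ∑ i, MvPolynomial.pderiv i (G i) = 0) :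
    ∫ y : EuclideanSpace ℝ (Fin n),
      radialWeight y * polyEval (∑ i, MvPolynomial.X i * G i) y = 0 := by
  have hint : ∀ f : EuclideanSpace ℝ (Fin n) → ℝ, Continuous f →
      Integrable (fun y => radialWeight y * f y) := fun f hf =>
    (continuous_radialWeight.mul hf).integrable_of_hasCompactSupport
      hasCompactSupport_radialWeight.mul_right
  have hder : ∀ (i : Fin n) (y : EuclideanSpace ℝ (Fin n)),
      fderiv ℝ (fun y : EuclideanSpace ℝ (Fin n) => radialWeight y ^ 2) y
        (EuclideanSpace.single i 1) = -4 * radialWeight y * y i := fun i y => by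
    rw [(hasFDerivAt_radialWeight_sq y).fderiv]
    simp [EuclideanSpace.inner_single_right]
  have key : ∀ i, ∫ y : EuclideanSpace ℝ (Fin n), radialWeight y ^ 2 *
      polyEval (MvPolynomial.pderiv i (G i)) y =
      4 * ∫ y, radialWeight y * polyEval (MvPolynomial.X i * G i) y := fun i => by
    have h := integral_mul_fderiv_eq_neg_fderiv_mul_of_integrable (μ := volume)
      (f := fun y : EuclideanSpace ℝ (Fin n) => radialWeight y ^ 2) (g := polyEval (G i))
      (v := EuclideanSpace.single i 1) ?_ ?_ ?_
      (fun y _ => (hasFDerivAt_radialWeight_sq y).differentiableAt)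
      (fun y _ => (hasFDerivAt_polyEval (G i) y).differentiableAt)
    · simp only [hder, fderiv_polyEval_single] at h
      rw [h, ← integral_neg, ← integral_const_mul]
      congr 1
      ext y
      rw [polyEval_mul, polyEval_X]
      ring
    · simp only [hder]
      refine (hint (fun y => -4 * y i * polyEval (G i) y) ?_).congr (.of_forall fun y => ?_)
      · have := continuous_polyEval (G i)
        fun_prop
      · simp only; ring
    · simp only [fderiv_polyEval_single]
      refine (hint (fun y => radialWeight y * polyEval (MvPolynomial.pderiv i (G i)) y)
        (continuous_radialWeight.mul (continuous_polyEval _))).congr (.of_forall fun y => ?_)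
      simp only; ring
    · refine (hint (fun y => radialWeight y * polyEval (G i) y)
        (continuous_radialWeight.mul (continuous_polyEval _))).congr (.of_forall fun y => ?_)
      simp only; ring
  have hsum : ∑ i, ∫ y : EuclideanSpace ℝ (Fin n), radialWeight y ^ 2 *
      polyEval (MvPolynomial.pderiv i (G i)) y = 0 := by
    rw [← integral_finsetSum]
    · simp only [← Finset.mul_sum, ← polyEval_sum, hG]
      simp [polyEval]
    · intro i _
      refine (hint (fun y => radialWeight y * polyEval (MvPolynomial.pderiv i (G i)) y)
        (continuous_radialWeight.mul (continuous_polyEval _))).congr (.of_forall fun y => ?_)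
      simp only; ring
  simp only [polyEval_sum, Finset.mul_sum]
  rw [integral_finsetSum _ fun i _ => hint _ (continuous_polyEval _)]
  simp only [key, ← Finset.mul_sum] at hsum
  linarith

/-- Harmonic homogeneous polynomials of different degrees are orthogonal for radial weights. -/
theorem integral_radialWeight_mul_eq_zero {p q : MvPolynomial (Fin n) ℝ} {k m : ℕ}
    (hp : p.IsHomogeneous k) (hq : q.IsHomogeneous m) (hpL : polyLaplacian p = 0)
    (hqL : polyLaplacian q = 0) (hkm : k ≠ m) :
    ∫ y : EuclideanSpace ℝ (Fin n), radialWeight y * polyEval (p * q) y = 0 := by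
  -- The field `p ∇q - q ∇p` is divergence-free by harmonicity, and Euler's identity turns its
  -- radial component into `(m - k) * p * q`.
  have h := integral_radialWeight_mul_euler
    (fun i => p * MvPolynomial.pderiv i q - q * MvPolynomial.pderiv i p) ?_
  · have he : ∑ i, MvPolynomial.X i *
        (p * MvPolynomial.pderiv i q - q * MvPolynomial.pderiv i p) =
        MvPolynomial.C ((m : ℝ) - k) * (p * q) := by
      have e1 := hp.sum_X_mul_pderiv
      have e2 := hq.sum_X_mul_pderiv
      have : ∑ i, MvPolynomial.X i *
        (p * MvPolynomial.pderiv i q - q * MvPolynomial.pderiv i p) =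
        p * ∑ i, MvPolynomial.X i * MvPolynomial.pderiv i q -
          q * ∑ i, MvPolynomial.X i * MvPolynomial.pderiv i p := by
        rw [Finset.mul_sum, Finset.mul_sum, ← Finset.sum_sub_distrib]
        exact Finset.sum_congr rfl fun i _ => by ring
      rw [this, e1, e2]
      simp only [nsmul_eq_mul, map_sub, map_natCast]
      ring
    have hC : ∀ y : EuclideanSpace ℝ (Fin n), radialWeight y *
        polyEval (MvPolynomial.C ((m : ℝ) - k) * (p * q)) y =
        ((m : ℝ) - k) * (radialWeight y * polyEval (p * q) y) := fun y => by
      rw [polyEval_mul _ (p * q)]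
      simp only [polyEval, MvPolynomial.eval_C]
      ring
    rw [he] at h
    simp only [hC, integral_const_mul] at h
    refine (mul_eq_zero.1 h).resolve_left (sub_ne_zero.2 ?_)
    exact_mod_cast hkm.symm
  · have : ∀ i, MvPolynomial.pderiv i
        (p * MvPolynomial.pderiv i q - q * MvPolynomial.pderiv i p) =
        p * MvPolynomial.pderiv i (MvPolynomial.pderiv i q) -
          q * MvPolynomial.pderiv i (MvPolynomial.pderiv i p) := fun i => by
      simp only [map_sub, Derivation.leibniz, smul_eq_mul]
      ring
    simp only [this, Finset.sum_sub_distrib, ← Finset.mul_sum]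
    rw [← polyLaplacian, ← polyLaplacian, hpL, hqL]
    simp

/-- If a harmonic homogeneous polynomial `q` has the same sign as a nonzero harmonic homogeneous
polynomial of a different degree, then `q = 0`. -/
theorem eq_zero_of_mul_nonneg {p q : MvPolynomial (Fin n) ℝ} {k m : ℕ}
    (hp : p.IsHomogeneous k) (hq : q.IsHomogeneous m) (hpL : polyLaplacian p = 0)
    (hqL : polyLaplacian q = 0) (hkm : k ≠ m) (hp0 : p ≠ 0)
    (hpq : ∀ y, 0 ≤ polyEval p y * polyEval q y) : q = 0 := by
  have hI := integral_radialWeight_mul_eq_zero hp hq hpL hqL hkm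
  refine (mul_eq_zero.1 (eq_zero_of_polyEval_eq_zero fun y => ?_)).resolve_left hp0
  by_contra hy
  -- Homogeneity lets a point where the product is nonzero be scaled into the open unit ball, where
  -- the weight is positive.
  set c : ℝ := (1 + ‖y‖)⁻¹ with hc
  have hc0 : 0 < c := by positivity
  have hcy : ‖c • y‖ < 1 := by
    rw [norm_smul, Real.norm_of_nonneg hc0.le, hc, inv_mul_lt_one₀ (by positivity)]
    linarith
  refine (Continuous.integral_pos_of_hasCompactSupport_nonneg_nonzero (μ := volume)
    (f := fun y => radialWeight y * polyEval (p * q) y) (x := c • y)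
    (continuous_radialWeight.mul (continuous_polyEval _))
    hasCompactSupport_radialWeight.mul_right (fun z => ?_) ?_).ne' hI
  · simp only [Pi.zero_apply, polyEval_mul]
    exact mul_nonneg (le_max_left _ _) (hpq z)
  · rw [(hp.mul hq).polyEval_smul]
    exact mul_ne_zero (radialWeight_pos hcy).ne' (mul_ne_zero (pow_pos hc0 _).ne' hy)

end Weight

/-! ### Blow-up at a zero -/

section BlowUp

variable {n : ℕ}

/-- Translation of a multivariate polynomial. -/
noncomputable def polyTranslate (p : MvPolynomial (Fin n) ℝ) (x : EuclideanSpace ℝ (Fin n)) :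
    MvPolynomial (Fin n) ℝ :=
  MvPolynomial.bind₁ (fun i => MvPolynomial.C (x i) + MvPolynomial.X i) p

theorem polyEval_polyTranslate (p : MvPolynomial (Fin n) ℝ) (x y : EuclideanSpace ℝ (Fin n)) :
    polyEval (polyTranslate p x) y = polyEval p (x + y) := by
  simp only [polyEval, polyTranslate, ← MvPolynomial.coe_aeval_eq_eval,
    RingHom.coe_coe, MvPolynomial.aeval_bind₁]
  simp

theorem polyLaplacian_polyTranslate {p : MvPolynomial (Fin n) ℝ}
    (hp : ∀ y, Laplacian.laplacian (polyEval p) y = 0) (x : EuclideanSpace ℝ (Fin n)) :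
    polyLaplacian (polyTranslate p x) = 0 := by
  refine eq_zero_of_polyEval_eq_zero fun y => ?_
  have he : polyEval (polyTranslate p x) = fun y => polyEval p (x + y) :=
    funext (polyEval_polyTranslate p x)
  rw [← laplacian_polyEval, he, ← hp (x + y),
    InnerProductSpace.laplacian_eq_iteratedFDeriv_stdOrthonormalBasis,
    InnerProductSpace.laplacian_eq_iteratedFDeriv_stdOrthonormalBasis]
  simp only [iteratedFDeriv_comp_add_left]

theorem polyEval_smul_eq_sum (p : MvPolynomial (Fin n) ℝ) (r : ℝ)
    (a : EuclideanSpace ℝ (Fin n)) :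
    polyEval p (r • a) = ∑ k ∈ Finset.range (p.totalDegree + 1),
      r ^ k * polyEval (MvPolynomial.homogeneousComponent k p) a := by
  conv_lhs => rw [← MvPolynomial.sum_homogeneousComponent p, polyEval_sum]
  exact Finset.sum_congr rfl fun k _ =>
    (MvPolynomial.homogeneousComponent_isHomogeneous k p).polyEval_smul r a

theorem exists_leading_homogeneousComponent {p : MvPolynomial (Fin n) ℝ} (hp : p ≠ 0) :
    ∃ m, MvPolynomial.homogeneousComponent m p ≠ 0 ∧
      ∀ k < m, MvPolynomial.homogeneousComponent k p = 0 := by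
  classical
  have hex : ∃ m, MvPolynomial.homogeneousComponent m p ≠ 0 := by
    by_contra! h
    exact hp (by rw [← MvPolynomial.sum_homogeneousComponent p]; simp [h])
  exact ⟨Nat.find hex, Nat.find_spec hex, fun k hk => not_not.1 (Nat.find_min hex hk)⟩

theorem tendsto_polyEval_div_pow {p : MvPolynomial (Fin n) ℝ} {m : ℕ}
    (hm : MvPolynomial.homogeneousComponent m p ≠ 0)
    (hlt : ∀ k < m, MvPolynomial.homogeneousComponent k p = 0)
    (a : EuclideanSpace ℝ (Fin n)) :
    Tendsto (fun r : ℝ => polyEval p (r • a) / r ^ m) (𝓝[>] 0)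
      (𝓝 (polyEval (MvPolynomial.homogeneousComponent m p) a)) := by
  -- The truncation of `k - m` for `k < m` is harmless: those components vanish.
  have hc : Tendsto (fun r : ℝ => ∑ k ∈ Finset.range (p.totalDegree + 1),
      r ^ (k - m) * polyEval (MvPolynomial.homogeneousComponent k p) a) (𝓝[>] 0)
      (𝓝 (∑ k ∈ Finset.range (p.totalDegree + 1),
        0 ^ (k - m) * polyEval (MvPolynomial.homogeneousComponent k p) a)) := by
    refine Tendsto.mono_left (Continuous.tendsto ?_ 0) nhdsWithin_le_nhds
    fun_prop
  have h0 : ∑ k ∈ Finset.range (p.totalDegree + 1),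
      (0 : ℝ) ^ (k - m) * polyEval (MvPolynomial.homogeneousComponent k p) a =
      polyEval (MvPolynomial.homogeneousComponent m p) a := by
    rw [Finset.sum_eq_single m]
    · simp
    · intro k _ hk
      rcases lt_or_gt_of_ne hk with h | h
      · simp [hlt k h, polyEval]
      · rw [zero_pow (by omega), zero_mul]
    · intro h
      exact absurd (MvPolynomial.homogeneousComponent_eq_zero m p (by simpa using h)) hm
  rw [h0] at hc
  refine hc.congr' ?_
  filter_upwards [self_mem_nhdsWithin] with r hr
  have hr0 : r ≠ 0 := ne_of_gt hr
  rw [polyEval_smul_eq_sum, Finset.sum_div]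
  refine Finset.sum_congr rfl fun k _ => ?_
  rcases lt_or_ge k m with h | h
  · simp [hlt k h, polyEval]
  · rw [pow_sub₀ _ hr0 h]
    field_simp

/-- If the zeros of `f` at small scales accumulate on the hyperplane orthogonal to `e`, then the
leading homogeneous part of `f` does not change sign on either side of that hyperplane. -/
theorem mul_nonneg_of_zeros_near_hyperplane {f g : EuclideanSpace ℝ (Fin n) → ℝ} {m : ℕ}
    {e : EuclideanSpace ℝ (Fin n)} (hf : Continuous f)
    (hg : ∀ (r : ℝ) y, g (r • y) = r ^ m * g y)
    (hlim : ∀ a, Tendsto (fun r : ℝ => f (r • a) / r ^ m) (𝓝[>] 0) (𝓝 (g a)))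
    (hfreq : ∀ ε > 0, ∃ᶠ r : ℝ in 𝓝[>] 0, ∀ y, ‖y‖ ≤ 1 → f (r • y) = 0 → |inner ℝ e y| ≤ ε)
    {a b : EuclideanSpace ℝ (Fin n)} (ha : 0 < inner ℝ e a) (hb : 0 < inner ℝ e b) :
    0 ≤ g a * g b := by
  wlog hnorm : ‖a‖ ≤ 1 ∧ ‖b‖ ≤ 1 generalizing a b
  · have hscale : ∀ y : EuclideanSpace ℝ (Fin n), ‖(1 + ‖y‖)⁻¹ • y‖ ≤ 1 := fun y => by
      rw [norm_smul, Real.norm_of_nonneg (by positivity), inv_mul_le_one₀ (by positivity)]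
      linarith
    have h := this (a := (1 + ‖a‖)⁻¹ • a) (b := (1 + ‖b‖)⁻¹ • b)
      (by rw [inner_smul_right]; positivity) (by rw [inner_smul_right]; positivity)
      ⟨hscale a, hscale b⟩
    rw [hg, hg, mul_mul_mul_comm] at h
    exact nonneg_of_mul_nonneg_right h (by positivity)
  by_contra! hneg
  set ε := min (inner ℝ e a) (inner ℝ e b) with hε
  have hε0 : 0 < ε := lt_min ha hb
  obtain ⟨r, ⟨hr, hsign⟩, hr0⟩ := (((hfreq (ε / 2) (by positivity)).and_eventually
    (((hlim a).mul (hlim b)).eventually (gt_mem_nhds hneg))).and_eventually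
    self_mem_nhdsWithin).exists
  have hr0 : 0 < r := hr0
  have hprod : f (r • a) * f (r • b) < 0 := by
    rw [div_mul_div_comm] at hsign
    by_contra! h
    exact absurd hsign (not_lt.2 (div_nonneg h (by positivity)))
  -- The segment from `a` to `b` stays at height at least `ε` above the hyperplane, whereas zeros at
  -- scale `r` have height at most `ε / 2`.
  obtain ⟨t, ht, hzero⟩ : ∃ t ∈ Set.uIcc (0 : ℝ) 1, f (r • (a + t • (b - a))) = 0 := by
    refine intermediate_value_uIcc (f := fun t : ℝ => f (r • (a + t • (b - a))))
      (Continuous.continuousOn (by fun_prop)) ?_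
    simp only [zero_smul, add_zero, one_smul, add_sub_cancel]
    rcases mul_neg_iff.1 hprod with ⟨h1, h2⟩ | ⟨h1, h2⟩
    · exact Set.mem_uIcc_of_ge h2.le h1.le
    · exact Set.mem_uIcc_of_le h1.le h2.le
  rw [Set.uIcc_of_le zero_le_one] at ht
  have hcomb : a + t • (b - a) = (1 - t) • a + t • b := by module
  have h1 : ‖a + t • (b - a)‖ ≤ 1 := by
    rw [hcomb]
    have := convex_closedBall (0 : EuclideanSpace ℝ (Fin n)) 1
      (mem_closedBall_zero_iff.2 hnorm.1) (mem_closedBall_zero_iff.2 hnorm.2)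
      (sub_nonneg.2 ht.2) ht.1 (by ring)
    exact mem_closedBall_zero_iff.1 this
  have h2 := (le_abs_self _).trans (hr _ h1 hzero)
  rw [hcomb, inner_add_right, inner_smul_right, inner_smul_right] at h2
  have h3 : ε ≤ inner ℝ e a := min_le_left _ _
  have h4 : ε ≤ inner ℝ e b := min_le_right _ _
  nlinarith [mul_le_mul_of_nonneg_left h3 (sub_nonneg.2 ht.2), mul_le_mul_of_nonneg_left h4 ht.1]

/-- A homogeneous harmonic polynomial of degree at least two that does not change sign on an open
half-space vanishes. -/
theorem eq_zero_of_nonneg_on_halfSpace {q : MvPolynomial (Fin n) ℝ} {m : ℕ} (hm : 2 ≤ m)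
    (hq : q.IsHomogeneous m) (hqL : polyLaplacian q = 0) {e : EuclideanSpace ℝ (Fin n)}
    (he : e ≠ 0) (hpos : ∀ y, 0 < inner ℝ e y → 0 ≤ polyEval q y) : q = 0 := by
  have hneg : ∀ y, polyEval q (-y) = (-1) ^ m * polyEval q y := fun y => by
    rw [← hq.polyEval_smul, neg_one_smul]
  rcases Nat.even_or_odd m with hev | hodd
  · rw [hev.neg_one_pow] at hneg
    have hclosed : ∀ y, 0 ≤ inner ℝ e y → 0 ≤ polyEval q y := fun y hy => by
      have ht : Tendsto (fun t : ℝ => polyEval q (y + t • e)) (𝓝[>] 0)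
          (𝓝 (polyEval q (y + (0 : ℝ) • e))) := by
        refine Tendsto.mono_left (Continuous.tendsto ?_ 0) nhdsWithin_le_nhds
        exact (continuous_polyEval q).comp (by fun_prop)
      rw [zero_smul, add_zero] at ht
      refine ge_of_tendsto ht ?_
      filter_upwards [self_mem_nhdsWithin] with t (ht0 : 0 < t)
      refine hpos _ ?_
      rw [inner_add_right, inner_smul_right]
      have := real_inner_self_pos.2 he
      positivity
    -- By evenness `q` is nonnegative everywhere; compare it with the constant `1`, of degree `0 ≠
    -- m`.
    refine eq_zero_of_mul_nonneg (p := 1) (k := 0) (MvPolynomial.isHomogeneous_one _ _) hq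
      (by simp [polyLaplacian]) hqL (by omega) one_ne_zero fun y => ?_
    have h1 : polyEval (1 : MvPolynomial (Fin n) ℝ) y = 1 := by simp [polyEval]
    rw [h1, one_mul]
    rcases le_total 0 (inner ℝ e y) with h | h
    · exact hclosed y h
    · have := hclosed (-y) (by rw [inner_neg_right]; linarith)
      rwa [hneg, one_mul] at this
  · rw [hodd.neg_one_pow] at hneg
    -- By oddness `q` has the sign of this linear form, of degree `1 ≠ m`.
    set l : MvPolynomial (Fin n) ℝ := ∑ i, MvPolynomial.C (e i) * MvPolynomial.X i with hl
    have hle : ∀ y, polyEval l y = inner ℝ e y := fun y => by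
      rw [hl, polyEval_sum, PiLp.inner_apply]
      refine Finset.sum_congr rfl fun i _ => ?_
      simp [polyEval, mul_comm]
    refine eq_zero_of_mul_nonneg (p := l) (k := 1) ?_ hq ?_ hqL (by omega) ?_ fun y => ?_
    · refine MvPolynomial.IsHomogeneous.sum _ _ _ fun i _ => ?_
      simpa using (MvPolynomial.isHomogeneous_C (Fin n) (e i)).mul
        (MvPolynomial.isHomogeneous_X ℝ i)
    · refine Finset.sum_eq_zero fun i _ => ?_
      have : MvPolynomial.pderiv i l = MvPolynomial.C (e i) := by
        simp [hl, MvPolynomial.pderiv_X, Pi.single_apply, Derivation.leibniz]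
      rw [this, MvPolynomial.pderiv_C]
    · intro h0
      have := hle e
      rw [h0] at this
      exact (real_inner_self_pos.2 he).ne (by simpa [polyEval] using this)
    · rw [hle]
      rcases lt_trichotomy (inner ℝ e y) 0 with h | h | h
      · have := hpos (-y) (by rw [inner_neg_right]; linarith)
        rw [hneg] at this
        exact mul_nonneg_of_nonpos_of_nonpos h.le (by linarith)
      · rw [h, zero_mul]
      · exact mul_nonneg h.le (hpos y h)

/-- If the zeros of a nonzero harmonic polynomial `p` with `p(0) = 0` at small scales accumulate on
a hyperplane, then the differential of `p` at the origin does not vanish. -/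
theorem fderiv_ne_zero_of_zeros_near_hyperplane {p : MvPolynomial (Fin n) ℝ} (hp : p ≠ 0)
    (hpL : polyLaplacian p = 0) (hp0 : polyEval p 0 = 0) {e : EuclideanSpace ℝ (Fin n)}
    (he : e ≠ 0) (hfreq : ∀ ε > 0, ∃ᶠ r : ℝ in 𝓝[>] 0,
      ∀ y, ‖y‖ ≤ 1 → polyEval p (r • y) = 0 → |inner ℝ e y| ≤ ε) :
    fderiv ℝ (polyEval p) 0 ≠ 0 := by
  intro hD
  obtain ⟨m, hm, hlt⟩ := exists_leading_homogeneousComponent hp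
  have hlim := tendsto_polyEval_div_pow hm hlt
  set q := MvPolynomial.homogeneousComponent m p with hq
  have hqh : q.IsHomogeneous m := MvPolynomial.homogeneousComponent_isHomogeneous m p
  have hline : ∀ a, HasDerivAt (fun r : ℝ => polyEval p (r • a)) 0 0 := fun a => by
    have h1 : HasFDerivAt (polyEval p) (0 : EuclideanSpace ℝ (Fin n) →L[ℝ] ℝ) ((0 : ℝ) • a) := by
      rw [zero_smul, ← hD]
      exact (hasFDerivAt_polyEval p 0).differentiableAt.hasFDerivAt
    have h2 : HasDerivAt (fun r : ℝ => r • a) ((1 : ℝ) • a) 0 :=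
      (hasDerivAt_id (0 : ℝ)).smul_const a
    exact h1.comp_hasDerivAt (0 : ℝ) h2
  -- For `m = 0` or `m = 1` the blow-up limit is the value or the directional derivative at the
  -- origin, and both vanish.
  have hm2 : 2 ≤ m := by
    by_contra! hlt2
    refine hm (eq_zero_of_polyEval_eq_zero fun a => tendsto_nhds_unique (hlim a) ?_)
    interval_cases m
    · have := (hline a).continuousAt.tendsto.mono_left (nhdsWithin_le_nhds (s := Set.Ioi 0))
      simpa [hp0] using this
    · have := (hasDerivAt_iff_tendsto_slope.1 (hline a)).mono_left
        (nhdsWithin_mono 0 fun r (hr : 0 < r) => hr.ne')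
      refine this.congr fun r => ?_
      simp [slope_def_field, hp0]
  obtain ⟨k, rfl⟩ : ∃ k, m = k + 2 := ⟨m - 2, by omega⟩
  have hqL : polyLaplacian q = 0 := polyLaplacian_homogeneousComponent hpL k
  have hsign : ∀ a b, 0 < inner ℝ e a → 0 < inner ℝ e b → 0 ≤ polyEval q a * polyEval q b :=
    fun a b ha hb => mul_nonneg_of_zeros_near_hyperplane (continuous_polyEval p)
      hqh.polyEval_smul hlim hfreq ha hb
  by_cases hex : ∃ a, 0 < inner ℝ e a ∧ 0 < polyEval q a
  · obtain ⟨a, ha, hqa⟩ := hex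
    exact hm (eq_zero_of_nonneg_on_halfSpace hm2 hqh hqL he fun b hb =>
      nonneg_of_mul_nonneg_right (hsign a b ha hb) hqa)
  · push Not at hex
    have hn : -q = 0 := by
      refine eq_zero_of_nonneg_on_halfSpace hm2 hqh.neg ?_ he fun b hb => ?_
      · simpa [polyLaplacian] using hqL
      · have := hex b hb
        simpa [polyEval] using this
    exact hm (neg_eq_zero.1 hn)

end BlowUp

/-! ### Flatness and hyperplanes -/

section Flat

variable {n : ℕ}

theorem finrank_orthogonal_singleton_add_one {v : EuclideanSpace ℝ (Fin n)} (hv : v ≠ 0) :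
    Module.finrank ℝ (Submodule.span ℝ {v})ᗮ + 1 = n := by
  have := (Submodule.span ℝ {v}).finrank_add_finrank_orthogonal
  rw [finrank_span_singleton hv, finrank_euclideanSpace_fin] at this
  omega

/-- Take a unit normal to a nearly optimal hyperplane. The extra `r` is slack that avoids showing
the infimum is attained; it still tends to zero. -/
theorem exists_unit_normal_of_localFlatness (hn : 0 < n) {A : Set (EuclideanSpace ℝ (Fin n))}
    {x : EuclideanSpace ℝ (Fin n)} (hx : x ∈ A) {r : ℝ} (hr : 0 < r) :
    ∃ e : EuclideanSpace ℝ (Fin n), ‖e‖ = 1 ∧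
      ∀ y, ‖y‖ ≤ 1 → x + r • y ∈ A → |inner ℝ e y| ≤ localFlatness A x r + r := by
  have : Nonempty (LinearHyperplane n) :=
    ⟨⟨_, finrank_orthogonal_singleton_add_one
      (v := EuclideanSpace.single ⟨0, hn⟩ (1 : ℝ)) (by simp)⟩⟩
  have hlt : (⨅ L : LinearHyperplane n, Metric.hausdorffDist (A ∩ Metric.closedBall x r)
      (((fun y => x + y) '' (L.1 : Set (EuclideanSpace ℝ (Fin n)))) ∩ Metric.closedBall x r)) <
      r * (localFlatness A x r + r) := by
    have : r * (localFlatness A x r + r) = (⨅ L : LinearHyperplane n,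
      Metric.hausdorffDist (A ∩ Metric.closedBall x r)
      (((fun y => x + y) '' (L.1 : Set (EuclideanSpace ℝ (Fin n)))) ∩ Metric.closedBall x r)) +
        r * r := by
      unfold localFlatness
      field_simp
    rw [this]
    have := mul_pos hr hr
    linarith
  obtain ⟨⟨L, hL⟩, hLlt⟩ := exists_lt_of_ciInf_lt hlt
  have hbot : Lᗮ ≠ ⊥ := fun h => by
    rw [Submodule.orthogonal_eq_bot_iff] at h
    rw [h, finrank_top, finrank_euclideanSpace_fin] at hL
    omega
  obtain ⟨v, hvL, hv⟩ := Submodule.exists_mem_ne_zero_of_ne_bot hbot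
  refine ⟨‖v‖⁻¹ • v, by simp [norm_smul, hv], fun y hy hyA => ?_⟩
  have hxball : x ∈ Metric.closedBall x r := Metric.mem_closedBall_self hr.le
  have hyball : x + r • y ∈ Metric.closedBall x r := by
    rw [Metric.mem_closedBall, dist_self_add_left, norm_smul, Real.norm_of_nonneg hr.le]
    exact mul_le_of_le_one_right hr.le hy
  obtain ⟨z, ⟨⟨w, hw, rfl⟩, -⟩, hz⟩ := Metric.exists_dist_lt_of_hausdorffDist_lt
    (Set.mem_inter hyA hyball) hLlt
    (Metric.hausdorffEDist_ne_top_of_nonempty_of_bounded ⟨x, hx, hxball⟩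
      ⟨x, ⟨0, L.zero_mem, add_zero x⟩, hxball⟩
      (Metric.isBounded_closedBall.subset Set.inter_subset_right)
      (Metric.isBounded_closedBall.subset Set.inter_subset_right))
  have hvw : inner ℝ (‖v‖⁻¹ • v) w = 0 := by
    rw [inner_smul_left, (Submodule.mem_orthogonal' L v).1 hvL w hw, mul_zero]
  have h1 : |inner ℝ (‖v‖⁻¹ • v) (r • y - w)| ≤ ‖r • y - w‖ := by
    refine (abs_real_inner_le_norm _ _).trans ?_
    simp [norm_smul, hv]
  rw [inner_sub_right, hvw, sub_zero, inner_smul_right, abs_mul, abs_of_pos hr] at h1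
  beta_reduce at hz
  rw [dist_add_left, dist_eq_norm] at hz
  exact le_of_mul_le_mul_left (h1.trans hz.le) hr

/-- The best hyperplane may rotate with the scale. A cluster point of the unit normals serves
infinitely many small scales, hence `∃ᶠ` rather than `∀ᶠ`. -/
theorem IsFlatPoint.exists_frequently_near_hyperplane (hn : 0 < n)
    {A : Set (EuclideanSpace ℝ (Fin n))} {x : EuclideanSpace ℝ (Fin n)} (h : IsFlatPoint A x) :
    ∃ e : EuclideanSpace ℝ (Fin n), ‖e‖ = 1 ∧ ∀ ε > 0, ∃ᶠ r : ℝ in 𝓝[>] 0,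
      ∀ y, ‖y‖ ≤ 1 → x + r • y ∈ A → |inner ℝ e y| ≤ ε := by
  have hex : ∀ r : ℝ, ∃ e : EuclideanSpace ℝ (Fin n), 0 < r → ‖e‖ = 1 ∧
      ∀ y, ‖y‖ ≤ 1 → x + r • y ∈ A → |inner ℝ e y| ≤ localFlatness A x r + r := fun r => by
    by_cases hr : 0 < r
    · obtain ⟨e, he⟩ := exists_unit_normal_of_localFlatness hn h.1 hr
      exact ⟨e, fun _ => he⟩
    · exact ⟨0, fun h => absurd h hr⟩
  choose e he using hex
  obtain ⟨e₀, he₀, hcl⟩ := (isCompact_sphere (0 : EuclideanSpace ℝ (Fin n)) 1).exists_mapClusterPt_of_frequently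
    (f := e) (l := 𝓝[>] 0) (by
      refine Eventually.frequently ?_
      filter_upwards [self_mem_nhdsWithin] with r hr
      simpa using (he r hr).1)
  refine ⟨e₀, by simpa using he₀, fun ε hε => ?_⟩
  have hsmall : Tendsto (fun r => localFlatness A x r + r) (𝓝[>] 0) (𝓝 0) := by
    simpa using h.2.add (tendsto_id.mono_left nhdsWithin_le_nhds)
  have hfr := mapClusterPt_iff_frequently.1 hcl _ (Metric.ball_mem_nhds e₀ (half_pos hε))
  refine ((hfr.and_eventually (hsmall.eventually (gt_mem_nhds (half_pos hε)))).and_eventually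
    self_mem_nhdsWithin).mono ?_
  rintro r ⟨⟨h1, h2⟩, h3⟩ y hy hyA
  have h4 := (he r h3).2 y hy hyA
  have h5 : |inner ℝ (e₀ - e r) y| ≤ ε / 2 := by
    refine (abs_real_inner_le_norm _ _).trans ?_
    rw [Metric.mem_ball, dist_comm, dist_eq_norm] at h1
    nlinarith [norm_nonneg (e₀ - e r), norm_nonneg y]
  have h6 : inner ℝ e₀ y = inner ℝ (e₀ - e r) y + inner ℝ (e r) y := by
    rw [← inner_add_left, sub_add_cancel]
  rw [h6]
  exact (abs_add_le _ _).trans (by linarith)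

theorem localFlatness_nonneg (A : Set (EuclideanSpace ℝ (Fin n)))
    (x : EuclideanSpace ℝ (Fin n)) {r : ℝ} (hr : 0 < r) : 0 ≤ localFlatness A x r :=
  mul_nonneg (by positivity) (Real.iInf_nonneg fun _ => Metric.hausdorffDist_nonneg)

theorem localFlatness_le {A : Set (EuclideanSpace ℝ (Fin n))}
    {x : EuclideanSpace ℝ (Fin n)} {r c : ℝ} (hr : 0 < r) (L : LinearHyperplane n)
    (h : Metric.hausdorffDist (A ∩ Metric.closedBall x r)
      (((fun y => x + y) '' (L.1 : Set (EuclideanSpace ℝ (Fin n)))) ∩ Metric.closedBall x r) ≤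
        c * r) : localFlatness A x r ≤ c := by
  unfold localFlatness
  rw [one_div_mul_eq_div, div_le_iff₀ hr]
  exact (ciInf_le ⟨0, by rintro _ ⟨L, rfl⟩; exact Metric.hausdorffDist_nonneg⟩ L).trans h

/-- A zero of a continuous function at which it is differentiable with nonvanishing differential
is a flat point of its zero set. -/
theorem isFlatPoint_zeroSet_of_fderiv_ne_zero {f : EuclideanSpace ℝ (Fin n) → ℝ}
    {x : EuclideanSpace ℝ (Fin n)} (hf : Continuous f) (hx : f x = 0)
    (hD : fderiv ℝ f x ≠ 0) : IsFlatPoint (zeroSet f) x := by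
  refine ⟨hx, ?_⟩
  have hdiff : DifferentiableAt ℝ f x := by
    by_contra h
    exact hD (fderiv_zero_of_not_differentiableAt h)
  set v := (InnerProductSpace.toDual ℝ (EuclideanSpace ℝ (Fin n))).symm (fderiv ℝ f x) with hv
  have hvD : ∀ u, fderiv ℝ f x u = inner ℝ v u := fun u => by
    rw [hv, InnerProductSpace.toDual_symm_apply]
  have hv0 : v ≠ 0 := by simpa [hv] using hD
  have hvn : 0 < ‖v‖ := norm_pos_iff.2 hv0
  set e := ‖v‖⁻¹ • v with he
  have hen : ‖e‖ = 1 := by simp [he, norm_smul, hv0]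
  have hee : inner ℝ e e = (1 : ℝ) := by rw [real_inner_self_eq_norm_sq, hen, one_pow]
  have hve : v = ‖v‖ • e := by rw [he, smul_smul, mul_inv_cancel₀ hvn.ne', one_smul]
  have hvi : ∀ u, inner ℝ v u = ‖v‖ * inner ℝ e u := fun u => by
    conv_lhs => rw [hve, real_inner_smul_left]
  set L : LinearHyperplane n :=
    ⟨(Submodule.span ℝ {v})ᗮ, finrank_orthogonal_singleton_add_one hv0⟩ with hL
  have hLmem : ∀ u, u ∈ L.1 ↔ inner ℝ e u = (0 : ℝ) := fun u => by
    rw [hL, Submodule.mem_orthogonal_singleton_iff_inner_right, hvi]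
    simp [hvn.ne']
  have hsmall : ∀ ε : ℝ, 0 < ε → ε < 1 →
      ∀ᶠ r in 𝓝[>] 0, localFlatness (zeroSet f) x r ≤ 2 * ε := fun ε hε hε1 => by
    -- With this constant the error is half of `ε * ‖v‖ * r`, the change of the linear part under a
    -- normal shift by `ε * r`.
    have hO := (hasFDerivAt_iff_isLittleO_nhds_zero.1 hdiff.hasFDerivAt).def
      (c := ε * ‖v‖ / 2) (by positivity)
    obtain ⟨δ, hδ, hball⟩ := Metric.eventually_nhds_iff.1 hO
    filter_upwards [Ioo_mem_nhdsGT hδ] with r hr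
    have happrox : ∀ u, ‖u‖ ≤ r → |f (x + u) - ‖v‖ * inner ℝ e u| ≤ ε * ‖v‖ / 2 * r :=
      fun u hu => by
        have := hball (y := u) (by simpa using hu.trans_lt hr.2)
        rw [hx, sub_zero, hvD, hvi, Real.norm_eq_abs] at this
        exact this.trans (by gcongr)
    have hr0 := hr.1
    refine localFlatness_le hr0 L (Metric.hausdorffDist_le_of_mem_dist (by positivity) ?_ ?_)
    · rintro y ⟨hy, hyb⟩
      obtain ⟨u, rfl⟩ : ∃ u, y = x + u := ⟨y - x, by abel⟩
      rw [Metric.mem_closedBall, dist_self_add_left] at hyb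
      have h1 := happrox u hyb
      rw [show f (x + u) = 0 from hy, zero_sub, abs_neg, abs_mul, abs_of_pos hvn] at h1
      have h2 : |inner ℝ e u| ≤ ε / 2 * r :=
        le_of_mul_le_mul_left (by linarith : ‖v‖ * |inner ℝ e u| ≤ ‖v‖ * (ε / 2 * r)) hvn
      -- Orthogonal projection onto the hyperplane does not increase the norm, so it stays in the
      -- ball.
      refine ⟨x + (u - (inner ℝ e u : ℝ) • e), ⟨⟨_, (hLmem _).2 ?_, rfl⟩, ?_⟩, ?_⟩
      · rw [inner_sub_right, inner_smul_right, hee, mul_one, sub_self]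
      · rw [Metric.mem_closedBall, dist_self_add_left]
        refine le_trans ?_ hyb
        refine le_of_sq_le_sq ?_ (norm_nonneg u)
        rw [norm_sub_sq_real, norm_smul, hen, inner_smul_right, real_inner_comm, mul_one,
          Real.norm_eq_abs, sq_abs]
        nlinarith [sq_nonneg (inner ℝ e u : ℝ)]
      · rw [dist_add_left, dist_eq_norm, sub_sub_cancel, norm_smul, hen, mul_one,
          Real.norm_eq_abs]
        nlinarith [mul_pos hε hr0]
    · rintro _ ⟨⟨w, hw, rfl⟩, hwb⟩
      rw [Metric.mem_closedBall, dist_self_add_left] at hwb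
      have hwe : inner ℝ e w = (0 : ℝ) := (hLmem w).1 hw
      have hεr : 0 < ε * r := mul_pos hε hr0
      -- Shrinking `w` by `1 - ε` leaves room in the ball for a normal shift of size up to `ε * r`,
      -- along which `f` changes sign.
      have hnorm : ∀ s : ℝ, |s| ≤ ε * r → ‖(1 - ε) • w + s • e‖ ≤ r := fun s hs => by
        refine (norm_add_le _ _).trans ?_
        rw [norm_smul, norm_smul, hen, mul_one, Real.norm_eq_abs, Real.norm_eq_abs,
          abs_of_pos (by linarith : 0 < 1 - ε)]
        nlinarith
      have hin : ∀ s : ℝ, inner ℝ e ((1 - ε) • w + s • e) = s := fun s => by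
        rw [inner_add_right, inner_smul_right, inner_smul_right, hwe, hee]
        ring
      have hpos : 0 ≤ f (x + ((1 - ε) • w + (ε * r) • e)) := by
        have := (abs_le.1 (happrox _ (hnorm (ε * r) (abs_of_pos hεr).le))).1
        rw [hin] at this
        nlinarith [mul_pos hvn hεr]
      have hneg : f (x + ((1 - ε) • w + (-(ε * r)) • e)) ≤ 0 := by
        have := (abs_le.1 (happrox _ (hnorm (-(ε * r)) (by rw [abs_neg, abs_of_pos hεr])))).2
        rw [hin] at this
        nlinarith [mul_pos hvn hεr]
      obtain ⟨s, hs, hfs⟩ := intermediate_value_Icc (by linarith : -(ε * r) ≤ ε * r)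
        (f := fun s : ℝ => f (x + ((1 - ε) • w + s • e)))
        (Continuous.continuousOn (by fun_prop)) ⟨hneg, hpos⟩
      have hs' : |s| ≤ ε * r := abs_le.2 hs
      refine ⟨x + ((1 - ε) • w + s • e), ⟨hfs, ?_⟩, ?_⟩
      · rw [Metric.mem_closedBall, dist_self_add_left]
        exact hnorm s hs'
      · have : w - ((1 - ε) • w + s • e) = ε • w - s • e := by module
        rw [dist_add_left, dist_eq_norm, this]
        refine (norm_sub_le _ _).trans ?_
        rw [norm_smul, norm_smul, hen, mul_one, Real.norm_eq_abs, Real.norm_eq_abs,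
          abs_of_pos hε]
        nlinarith
  rw [Metric.tendsto_nhds]
  intro η hη
  have hε : 0 < min (η / 4) (1 / 2) := by positivity
  filter_upwards [hsmall _ hε ((min_le_right _ _).trans_lt (by norm_num)), self_mem_nhdsWithin]
    with r h1 h2
  rw [Real.dist_eq, sub_zero, abs_of_nonneg (localFlatness_nonneg _ _ h2)]
  have := min_le_left (η / 4) (1 / 2)
  linarith

end Flat

theorem theorem1p3 (n : ℕ) (hn : 2 ≤ n) (h : EuclideanSpace ℝ (Fin n) → ℝ)
    (hharm : IsHarmonicPolynomial h) (hnc : ¬ ∃ c : ℝ, ∀ x, h x = c) :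
    {x | x ∈ zeroSet h ∧ IsFlatPoint (zeroSet h) x} =
      {x | x ∈ zeroSet h ∧ fderiv ℝ h x ≠ 0} := by
  obtain ⟨⟨p, hp⟩, hΔ⟩ := hharm
  obtain rfl : h = polyEval p := funext hp
  ext x
  refine and_congr_right fun hx => ⟨fun hflat => ?_, fun hD =>
    isFlatPoint_zeroSet_of_fderiv_ne_zero (continuous_polyEval p) hx hD⟩
  obtain ⟨e, he, hfreq⟩ := hflat.exists_frequently_near_hyperplane (by omega)
  have hT : polyEval (polyTranslate p x) = fun y => polyEval p (x + y) :=
    funext (polyEval_polyTranslate p x)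
  have hne : polyTranslate p x ≠ 0 := fun h0 => hnc ⟨0, fun y => by
    have := polyEval_polyTranslate p x (y - x)
    rw [h0, add_sub_cancel] at this
    simpa [polyEval] using this.symm⟩
  have key := fderiv_ne_zero_of_zeros_near_hyperplane hne
    (polyLaplacian_polyTranslate (fun y => (hΔ y trivial).2.eq_of_nhds) x)
    ((polyEval_polyTranslate p x 0).trans (by rw [add_zero]; exact hx)) (e := e) (by rintro rfl; simp at he)
    (by simp only [hT]; exact hfreq)
  rw [hT, fderiv_comp_add_left, add_zero] at key
  exact key
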